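/- Let $m$ items be sold to a single additive buyer whose budget $b>0$ is public. For a discrete distribution $D$ of nonnegative valuation profiles $v=(v_1,\dots,v_m)$ with support $T$: - $\mathrm{Rev}^b(D)$ is the supremum of the expected payment $\sum_{t\in T}D(t)\,p(t)$ over the mechanisms $(\pi,p)$, $\pi:T\to[0,1]^m$, $p:T\to\mathbb{R}$, such that $\pi(t)^\top t-p(t)\ge \pi(t')^\top t-p(t')$, $\pi(t)^\top t-p(t)\ge 0$ and $p(t)\le b$ for all $t,t'\in T$ (interim incentive compatibility, individual rationality and budget feasibility). - $\mathrm{SRev}^b(D)$ is the supremum of the expected payment obtainable by posting a price $q_j\ge 0$ for every item $j$, where a buyer of type $t$ buys a set $S$ of items that maximizes $\sum_{j\in S}(t_j-q_j)$ among the sets with $\sum_{j\in S}q_j\le b$ (ties are broken in favour of the seller). - $\mathrm{BRev}^b(D)=\sup_{0\le q\le b}\, q\cdot\Pr_{v\sim D}\bigl[\sum_j v_j\ge q\bigr]$ is the supremum of the expected payment obtainable by posting a price for the grand bundle of all items. Let $V=\times_j V_j$ be a discrete distribution of nonnegative valuation profiles that is independent across items, let $c>0$ be such that $\Pr_{v\sim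 V}[\|v\|_1\le c]>0$, and let $\hat V=V_{|(\|v\|_1\le c)}$ be $V$ conditioned on $\|v\|_1\le c$ (a weakly correlated distribution). Then $$\mathrm{Rev}^b(\hat V)\le 5\,\mathrm{SRev}^b(\hat V)+6\,\mathrm{BRev}^b(\hat V).$$ -/

import Mathlib

namespace BudgetAuction

/-- The `ℓ₁`-norm of a valuation profile. -/
noncomputable def l1 {m : ℕ} (t : Fin m → ℝ) : ℝ := ∑ j, |t j|

/-- A discrete distribution on valuation profiles is independent across items: `V = ×ⱼ Vⱼ`. -/
def IsIndependent {m : ℕ} (V : PMF (Fin m → ℝ)) : Prop :=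
  ∃ W : Fin m → PMF ℝ, ∀ t, V t = ∏ j, W j (t j)

/-- `V` conditioned on the event `‖v‖₁ ≤ c`, an event of positive probability: the mass of the
other profiles is removed and the remaining mass is renormalized. -/
noncomputable def capSum {m : ℕ} (V : PMF (Fin m → ℝ)) (c : ℝ)
    (h : ∃ t ∈ {t : Fin m → ℝ | l1 t ≤ c}, t ∈ V.support) : PMF (Fin m → ℝ) :=
  V.filter {t : Fin m → ℝ | l1 t ≤ c} h

/-- A distribution of nonnegative valuation profiles is weakly correlated if it is an independent
distribution of nonnegative profiles, conditioned on `‖v‖₁ ≤ c` for a threshold `c > 0`. -/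
def IsWeaklyCorrelated {m : ℕ} (D : PMF (Fin m → ℝ)) : Prop :=
  ∃ (V : PMF (Fin m → ℝ)) (c : ℝ) (h : ∃ t ∈ {t : Fin m → ℝ | l1 t ≤ c}, t ∈ V.support),
    IsIndependent V ∧ (∀ t ∈ V.support, ∀ j, 0 ≤ t j) ∧ 0 < c ∧ D = capSum V c h

/-- The direct mechanism with (interim) allocation rule `π` and payment rule `p` is truthful for
an additive buyer with type space `T` and public budget `b`. -/
structure IsTruthful {m : ℕ} (T : Set (Fin m → ℝ)) (b : ℝ)
    (π : (Fin m → ℝ) → (Fin m → ℝ)) (p : (Fin m → ℝ) → ℝ) : Prop where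
  incentiveCompatible : ∀ t ∈ T, ∀ t' ∈ T, π t' ⬝ᵥ t - p t' ≤ π t ⬝ᵥ t - p t
  individuallyRational : ∀ t ∈ T, 0 ≤ π t ⬝ᵥ t - p t
  probability : ∀ t ∈ T, ∀ j, 0 ≤ π t j ∧ π t j ≤ 1
  withinBudget : ∀ t ∈ T, p t ≤ b

/-- Expected payments of the truthful mechanisms, for the type distribution `D` and budget `b`. -/
def truthfulRevenues {m : ℕ} (b : ℝ) (D : PMF (Fin m → ℝ)) : Set ℝ :=
  {R | ∃ π p, IsTruthful D.support b π p ∧ HasSum (fun t => (D t).toReal * p t) R}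

/-- The optimal revenue `Revᵇ(D)` of a truthful mechanism. -/
noncomputable def Rev {m : ℕ} (b : ℝ) (D : PMF (Fin m → ℝ)) : ℝ := sSup (truthfulRevenues b D)

/-- At item prices `q`, the set `S` of items is an optimal purchase for an additive buyer of type
`t` with budget `b`: it is affordable and maximizes the utility among the affordable sets. -/
def IsOptimalPurchase {m : ℕ} (b : ℝ) (q t : Fin m → ℝ) (S : Finset (Fin m)) : Prop :=
  ∑ j ∈ S, q j ≤ b ∧
    ∀ S' : Finset (Fin m), ∑ j ∈ S', q j ≤ b → ∑ j ∈ S', (t j - q j) ≤ ∑ j ∈ S, (t j - q j)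

/-- Expected payments obtainable by posting a nonnegative price for each item. The buyer's purchase
`S t` can be any optimal one, so in the supremum ties are broken in favour of the seller. -/
def separateRevenues {m : ℕ} (b : ℝ) (D : PMF (Fin m → ℝ)) : Set ℝ :=
  {R | ∃ (q : Fin m → ℝ) (S : (Fin m → ℝ) → Finset (Fin m)), (∀ j, 0 ≤ q j) ∧
    (∀ t ∈ D.support, IsOptimalPurchase b q t (S t)) ∧
    HasSum (fun t => (D t).toReal * ∑ j ∈ S t, q j) R}

/-- The optimal revenue `SRevᵇ(D)` of pricing each item separately. -/
noncomputable def SRev {m : ℕ} (b : ℝ) (D : PMF (Fin m → ℝ)) : ℝ := sSup (separateRevenues b D)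

/-- Expected payments obtainable by posting a price `q` for the grand bundle. A price above the
budget is never paid, so `q ≤ b` may be assumed. -/
def bundleRevenues {m : ℕ} (b : ℝ) (D : PMF (Fin m → ℝ)) : Set ℝ :=
  {R | ∃ q : ℝ, 0 ≤ q ∧ q ≤ b ∧
    R = q * (D.toOuterMeasure {t : Fin m → ℝ | q ≤ ∑ j, t j}).toReal}

/-- The optimal revenue `BRevᵇ(D)` of pricing the grand bundle. -/
noncomputable def BRev {m : ℕ} (b : ℝ) (D : PMF (Fin m → ℝ)) : ℝ := sSup (bundleRevenues b D)

/-! The three sets of revenues are nonempty and bounded, so the suprema are genuine. -/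

theorem hasSum_toReal {m : ℕ} (D : PMF (Fin m → ℝ)) : HasSum (fun t => (D t).toReal) 1 := by
  have h := D.tsum_coe
  have h2 := ENNReal.hasSum_toReal (f := fun t => D t) (by rw [h]; simp)
  rwa [← ENNReal.tsum_toReal_eq (fun t => D.apply_ne_top t), h, ENNReal.toReal_one] at h2

theorem le_of_hasSum {m : ℕ} {b : ℝ} {D : PMF (Fin m → ℝ)} {p : (Fin m → ℝ) → ℝ} {R : ℝ}
    (hp : ∀ t ∈ D.support, p t ≤ b) (h : HasSum (fun t => (D t).toReal * p t) R) : R ≤ b := by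
  have h1 := (hasSum_toReal D).mul_right b
  rw [one_mul] at h1
  refine hasSum_le (fun t => ?_) h h1
  by_cases ht : t ∈ D.support
  · exact mul_le_mul_of_nonneg_left (hp t ht) ENNReal.toReal_nonneg
  · have h0 : D t = 0 := by simpa [PMF.mem_support_iff] using ht
    simp [h0]

theorem truthfulRevenues_bddAbove {m : ℕ} (b : ℝ) (D : PMF (Fin m → ℝ)) :
    BddAbove (truthfulRevenues b D) :=
  ⟨b, fun _ ⟨_, _, hM, hR⟩ => le_of_hasSum hM.withinBudget hR⟩

theorem truthfulRevenues_nonempty {m : ℕ} {b : ℝ} (hb : 0 ≤ b) (D : PMF (Fin m → ℝ)) :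
    (truthfulRevenues b D).Nonempty :=
  ⟨0, fun _ => 0, fun _ => 0, ⟨by simp, by simp, by simp, by simp [hb]⟩, by simp⟩

theorem separateRevenues_bddAbove {m : ℕ} (b : ℝ) (D : PMF (Fin m → ℝ)) :
    BddAbove (separateRevenues b D) :=
  ⟨b, fun _ ⟨_, _, _, hS, hR⟩ => le_of_hasSum (fun t ht => (hS t ht).1) hR⟩

theorem exists_isOptimalPurchase {m : ℕ} {b : ℝ} (hb : 0 ≤ b) (q t : Fin m → ℝ) :
    ∃ S, IsOptimalPurchase b q t S := by
  classical
  obtain ⟨S, hS, hmax⟩ := Finset.exists_max_image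
    (Finset.univ.filter fun S : Finset (Fin m) => ∑ j ∈ S, q j ≤ b)
    (fun S => ∑ j ∈ S, (t j - q j)) ⟨∅, by simp [hb]⟩
  exact ⟨S, by simpa using hS, fun S' h' => hmax S' (by simpa using h')⟩

theorem separateRevenues_nonempty {m : ℕ} {b : ℝ} (hb : 0 ≤ b) (D : PMF (Fin m → ℝ)) :
    (separateRevenues b D).Nonempty := by
  choose S hS using fun t : Fin m → ℝ => exists_isOptimalPurchase hb 0 t
  exact ⟨0, 0, S, fun _ => le_rfl, fun t _ => hS t, by simp⟩

theorem bundleRevenues_bddAbove {m : ℕ} (b : ℝ) (D : PMF (Fin m → ℝ)) :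
    BddAbove (bundleRevenues b D) := by
  refine ⟨b, ?_⟩
  rintro R ⟨q, h0, hq, rfl⟩
  have h1 : D.toOuterMeasure {t : Fin m → ℝ | q ≤ ∑ j, t j} ≤ 1 := by
    rw [PMF.toOuterMeasure_apply, ← D.tsum_coe]
    exact ENNReal.tsum_le_tsum fun t => Set.indicator_le_self _ _ t
  have h2 : (D.toOuterMeasure {t : Fin m → ℝ | q ≤ ∑ j, t j}).toReal ≤ 1 :=
    ENNReal.toReal_le_of_le_ofReal zero_le_one (by simpa using h1)
  exact (mul_le_of_le_one_right h0 h2).trans hq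

theorem bundleRevenues_nonempty {m : ℕ} {b : ℝ} (hb : 0 ≤ b) (D : PMF (Fin m → ℝ)) :
    (bundleRevenues b D).Nonempty :=
  ⟨0, 0, le_rfl, hb, by simp⟩

end BudgetAuction

/-!
The proof gives the stronger bound `Rev ≤ SRev + 6 * BRev`. Let `S v = ∑ i, v i` and
`a = min b c / 2`. A type with `S v ≥ a` pays at most `2 * a`, so by the bundle price `a` these types
contribute at most `2 * BRev`.

For a type with `S v < a` let `j` be a favourite item, one of largest value. When the values of the
other items are fixed, the payment minus the value received from them is the payment of a truthful
mechanism for item `j` alone, which a posted price matches (`sum_payment_le_of_posted_price_le`). The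
values being independent before the conditioning, the price can be taken to depend on `j` only: with
`v j < a` and other values of sum below `a`, the total stays below `2 * a`, where neither the
conditioning nor the budget is felt. Hence this part is at most `SRev`
(`exists_price_sum_payment_sub_le`).

There remains the mean of `Z = S - max` on `S < a`. As `Pr[S ≥ t] ≤ BRev / t` for `t ≤ b`, a first
bound on the tail of `Z` is `BRev / s`, whose integral diverges logarithmically. Exchanging the
coordinates of two profiles after the point where the partial sums of the first reach `t` gives
`Pr[Z ≥ 2t, S < a] * Pr[S < t] ≤ Pr[S ≥ t] ^ 2` (`sum_nonfavorite_mul_sum_le_sq`), which survives the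
conditioning because the exchanged profiles have sum at most `2 * a ≤ c`. The resulting quadratic
decay makes the mean at most `4 * BRev` (`sum_mul_le_of_tail_le`).

All of this is done with finite sums: a finite box carries the expected payment and the mass of the
distribution up to an arbitrarily small loss (`exists_box`).
-/

namespace BudgetAuction

open Finset

/-! ### Truthful mechanisms -/

theorem IsTruthful.mono {m : ℕ} {T T' : Set (Fin m → ℝ)} {b : ℝ}
    {π : (Fin m → ℝ) → (Fin m → ℝ)} {p : (Fin m → ℝ) → ℝ} (hM : IsTruthful T b π p)
    (h : T' ⊆ T) : IsTruthful T' b π p where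
  incentiveCompatible t ht t' ht' := hM.incentiveCompatible t (h ht) t' (h ht')
  individuallyRational t ht := hM.individuallyRational t (h ht)
  probability t ht := hM.probability t (h ht)
  withinBudget t ht := hM.withinBudget t (h ht)

theorem IsTruthful.payment_le_sum {m : ℕ} {T : Set (Fin m → ℝ)} {b : ℝ}
    {π : (Fin m → ℝ) → (Fin m → ℝ)} {p : (Fin m → ℝ) → ℝ} (hM : IsTruthful T b π p)
    {t : Fin m → ℝ} (ht : t ∈ T) (h0 : ∀ j, 0 ≤ t j) : p t ≤ ∑ j, t j := by
  refine (sub_nonneg.1 (hM.individuallyRational t ht)).trans (sum_le_sum fun j _ => ?_)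
  exact mul_le_of_le_one_left (h0 j) (hM.probability t ht j).2

theorem l1_eq_sum {m : ℕ} {t : Fin m → ℝ} (ht : ∀ j, 0 ≤ t j) : l1 t = ∑ j, t j :=
  sum_congr rfl fun j _ => abs_of_nonneg (ht j)

/-! ### One item: no mechanism beats the best posted price -/

/-- A mechanism `(x, p)` for one item on finitely many types, of weights `μ`: if no posted price
earns more than `R`, the payments in excess of a base option `(x₀, p₀)` total at most
`R * (1 - x₀)`, provided every type `t` weakly prefers its own option to the base. The general base
is what makes the induction work: once the lowest type is removed, its own option becomes the new base. -/
theorem sum_payment_sub_le_mul_one_sub (F : Finset ℝ) (μ x p : ℝ → ℝ) (R : ℝ)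
    (hμ : ∀ t ∈ F, 0 ≤ μ t) (hx : ∀ t ∈ F, x t ≤ 1)
    (hic : ∀ s ∈ F, ∀ t ∈ F, x s * t - p s ≤ x t * t - p t)
    (hR : ∀ q ∈ F, q * ∑ t ∈ F with q ≤ t, μ t ≤ R) (hR0 : 0 ≤ R)
    (x₀ p₀ : ℝ) (hx₀ : x₀ ≤ 1)
    (hbase : ∀ t ∈ F, x₀ ≤ x t ∧ p t - p₀ ≤ t * (x t - x₀)) :
    ∑ t ∈ F, μ t * (p t - p₀) ≤ R * (1 - x₀) := by
  induction F using Finset.induction_on_min generalizing x₀ p₀ with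
  | empty => simpa using mul_nonneg hR0 (sub_nonneg.2 hx₀)
  | insert a F ha ih =>
    have haF : a ∉ F := fun h => lt_irrefl _ (ha a h)
    have hmem : ∀ {t}, t ∈ F → t ∈ insert a F := fun h => mem_insert_of_mem h
    have ha' : a ∈ insert a F := mem_insert_self a F
    -- Incentive compatibility makes the option of the lowest type `a` a base for the other types.
    have h1 := ih (fun t ht => hμ t (hmem ht)) (fun t ht => hx t (hmem ht))
      (fun s hs t ht => hic s (hmem hs) t (hmem ht))
      (fun q hq => by
        have hq' := hR q (hmem hq)
        rwa [filter_insert, if_neg (not_le.2 (ha q hq))] at hq')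
      (x a) (p a) (hx a ha')
      (fun t ht => by
        have h2 := hic a ha' t (hmem ht)
        have h3 := hic t (hmem ht) a ha'
        have h4 := ha t ht
        refine ⟨?_, by linarith⟩
        by_contra h5
        nlinarith [mul_pos (sub_pos.2 h4) (sub_pos.2 (not_le.1 h5))])
    have h2 := hR a ha'
    have h3 : (insert a F).filter (a ≤ ·) = insert a F :=
      filter_true_of_mem fun t ht => by
        rcases mem_insert.1 ht with rfl | h
        · exact le_rfl
        · exact (ha t h).le
    rw [h3] at h2
    have hM : 0 ≤ ∑ t ∈ insert a F, μ t := sum_nonneg hμ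
    obtain ⟨hb1, hb2⟩ := hbase a ha'
    calc ∑ t ∈ insert a F, μ t * (p t - p₀)
        = ∑ t ∈ insert a F, (μ t * (p a - p₀) + μ t * (p t - p a)) :=
          sum_congr rfl fun t _ => by ring
      _ = (∑ t ∈ insert a F, μ t) * (p a - p₀) + ∑ t ∈ F, μ t * (p t - p a) := by
          rw [sum_add_distrib, ← sum_mul, sum_insert (f := fun t => μ t * (p t - p a)) haF]
          ring
      _ ≤ (∑ t ∈ insert a F, μ t) * (a * (x a - x₀)) + R * (1 - x a) :=
          add_le_add (mul_le_mul_of_nonneg_left hb2 hM) h1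
      _ = (a * ∑ t ∈ insert a F, μ t) * (x a - x₀) + R * (1 - x a) := by ring
      _ ≤ R * (x a - x₀) + R * (1 - x a) := by
          have := mul_le_mul_of_nonneg_right h2 (sub_nonneg.2 hb1)
          linarith
      _ = R * (1 - x₀) := by ring

theorem sum_payment_le_of_posted_price_le (F : Finset ℝ) (μ x p : ℝ → ℝ) (R : ℝ)
    (hμ : ∀ t ∈ F, 0 ≤ μ t) (hx : ∀ t ∈ F, 0 ≤ x t ∧ x t ≤ 1)
    (hic : ∀ s ∈ F, ∀ t ∈ F, x s * t - p s ≤ x t * t - p t)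
    (hir : ∀ t ∈ F, 0 ≤ x t * t - p t)
    (hR : ∀ q ∈ F, q * ∑ t ∈ F with q ≤ t, μ t ≤ R) (hR0 : 0 ≤ R) :
    ∑ t ∈ F, μ t * p t ≤ R := by
  have := sum_payment_sub_le_mul_one_sub F μ x p R hμ (fun t ht => (hx t ht).2) hic hR hR0 0 0
    zero_le_one (fun t ht => ⟨(hx t ht).1, by linarith [hir t ht]⟩)
  simpa using this

/-! ### The favourite item: fixing the values of the other items -/

/-- Summation over a box, one line in direction `j` at a time; a line is indexed by its profile with
`j`-th coordinate `0`. -/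
theorem sum_piFinset_eq_sum_update {m : ℕ} (A : Fin m → Finset ℝ) (j : Fin m)
    (f : (Fin m → ℝ) → ℝ) :
    ∑ v ∈ Fintype.piFinset A, f v =
      ∑ y ∈ Fintype.piFinset (Function.update A j {0}), ∑ x ∈ A j, f (Function.update y j x) := by
  rw [← sum_product']
  refine sum_nbij' (fun v => (Function.update v j 0, v j)) (fun z => Function.update z.1 j z.2)
    ?_ ?_ ?_ ?_ ?_
  · intro v hv
    rw [Fintype.mem_piFinset] at hv
    refine mem_product.2 ⟨Fintype.mem_piFinset.2 fun i => ?_, hv j⟩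
    by_cases h : i = j
    · subst h; simp
    · simpa [h] using hv i
  · rintro ⟨y, x⟩ hz
    obtain ⟨hy, hx⟩ := mem_product.1 hz
    rw [Fintype.mem_piFinset] at hy ⊢
    intro i
    by_cases h : i = j
    · subst h; simpa using hx
    · simpa [h] using hy i
  · intro v _; simp
  · rintro ⟨y, x⟩ hz
    obtain ⟨hy, hx⟩ := mem_product.1 hz
    have := Fintype.mem_piFinset.1 hy j
    simp only [Function.update_self, mem_singleton] at this
    simp only [Function.update_idem, Function.update_self, Prod.mk.injEq, and_true]
    rw [← this, Function.update_eq_self]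
  · intro v _; simp

theorem prod_update_apply {m : ℕ} (w : Fin m → ℝ → ℝ) (j : Fin m) (y : Fin m → ℝ) (x : ℝ) :
    ∏ i, w i (Function.update y j x i) = (∏ i ∈ univ.erase j, w i (y i)) * w j x := by
  rw [← prod_erase_mul _ _ (mem_univ j), Function.update_self]
  congr 1
  exact prod_congr rfl fun i hi => by rw [Function.update_of_ne (ne_of_mem_erase hi)]

theorem sum_update_apply {m : ℕ} (j : Fin m) (y : Fin m → ℝ) (x : ℝ) :
    ∑ i, Function.update y j x i = (∑ i ∈ univ.erase j, y i) + x := by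
  rw [← sum_erase_add _ _ (mem_univ j), Function.update_self]
  congr 1
  exact sum_congr rfl fun i hi => by rw [Function.update_of_ne (ne_of_mem_erase hi)]

theorem dotProduct_update {m : ℕ} (u y : Fin m → ℝ) (j : Fin m) (x : ℝ) :
    u ⬝ᵥ Function.update y j x = u j * x + ∑ i ∈ univ.erase j, u i * y i := by
  rw [dotProduct, ← add_sum_erase _ _ (mem_univ j), Function.update_self]
  congr 1
  exact sum_congr rfl fun i hi => by rw [Function.update_of_ne (ne_of_mem_erase hi)]

/-- On a set `G` of types of total value below `a`, the payments in excess of the value received from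
the items other than `j` are covered by the revenue of item `j` at a single posted price. With the
other values fixed, `v j ↦ (π v j, p v - ∑ i ≠ j, π v i * v i)` is a truthful mechanism for item `j`.
The optimal price could depend on the other values through the constraint on the total. It does not
have to: a profile with `v j < a` and with other values of sum below `a` has total below `2 * a ≤ c`,
so it may be counted in the revenue, and the price optimal for `w j` on `[0, a)` serves all of them. -/
theorem exists_price_sum_payment_sub_le {m : ℕ} (A : Fin m → Finset ℝ)
    (hA : ∀ i, ∀ x ∈ A i, 0 ≤ x) (w : Fin m → ℝ → ℝ) (hw : ∀ i, ∀ x ∈ A i, 0 ≤ w i x)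
    {a c : ℝ} (hac : 2 * a ≤ c) (j : Fin m) (G : Finset (Fin m → ℝ))
    (hG : ∀ v ∈ G, v ∈ Fintype.piFinset A ∧ ∑ i, v i < a)
    {b : ℝ} {π : (Fin m → ℝ) → (Fin m → ℝ)} {p : (Fin m → ℝ) → ℝ}
    (hM : IsTruthful (G : Set (Fin m → ℝ)) b π p) :
    ∃ q, 0 ≤ q ∧ ∑ v ∈ G, (∏ i, w i (v i)) * (p v - ∑ i ∈ univ.erase j, π v i * v i) ≤
      q * ∑ v ∈ Fintype.piFinset A with q ≤ v j ∧ ∑ i, v i ≤ c, ∏ i, w i (v i) := by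
  classical
  -- `0` is inserted only to have a maximizer when `A j` is empty.
  obtain ⟨q, hq, hmax⟩ := exists_max_image (insert 0 (A j))
    (fun q => q * ∑ x ∈ A j with q ≤ x ∧ x < a, w j x) ⟨0, mem_insert_self _ _⟩
  have hq0 : 0 ≤ q := by
    rcases mem_insert.1 hq with rfl | h
    · exact le_rfl
    · exact hA j q h
  refine ⟨q, hq0, ?_⟩
  have hG' : G = (Fintype.piFinset A).filter (· ∈ G) := by
    ext v; simp only [mem_filter]; exact ⟨fun h => ⟨(hG v h).1, h⟩, fun h => h.2⟩
  conv_lhs => rw [hG']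
  rw [sum_filter, sum_filter, sum_piFinset_eq_sum_update A j, sum_piFinset_eq_sum_update A j,
    mul_sum]
  refine sum_le_sum fun y hy => ?_
  have hyA : ∀ i ∈ univ.erase j, y i ∈ A i := fun i hi => by
    simpa [ne_of_mem_erase hi] using Fintype.mem_piFinset.1 hy i
  set W := ∏ i ∈ univ.erase j, w i (y i) with hWdef
  have hW : 0 ≤ W := prod_nonneg fun i hi => hw i _ (hyA i hi)
  have hl : 0 ≤ ∑ i ∈ univ.erase j, y i := sum_nonneg fun i hi => hA i _ (hyA i hi)
  simp only [prod_update_apply, sum_update_apply, Function.update_self, ← hWdef]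
  rw [← sum_filter, ← sum_filter]
  set H := (A j).filter fun x => Function.update y j x ∈ G with hH
  have hrhs : 0 ≤ q * ∑ x ∈ A j with q ≤ x ∧ ∑ i ∈ univ.erase j, y i + x ≤ c, W * w j x :=
    mul_nonneg hq0 (sum_nonneg fun x hx => mul_nonneg hW (hw j x (mem_filter.1 hx).1))
  rcases H.eq_empty_or_nonempty with hE | ⟨x₀, hx₀⟩
  · rw [hE, sum_empty]; exact hrhs
  -- A line that meets `G` has other values of sum below `a`.
  have hla : ∑ i ∈ univ.erase j, y i < a := by
    obtain ⟨h1, h2⟩ := mem_filter.1 hx₀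
    have := (hG _ h2).2
    rw [sum_update_apply] at this
    linarith [hA j _ h1]
  have hxa : ∀ x ∈ H, x ∈ A j ∧ x < a := fun x hx => by
    obtain ⟨h1, h2⟩ := mem_filter.1 hx
    have := (hG _ h2).2
    rw [sum_update_apply] at this
    exact ⟨h1, by linarith⟩
  have herase : ∀ x, ∑ i ∈ univ.erase j, π (Function.update y j x) i * Function.update y j x i =
      ∑ i ∈ univ.erase j, π (Function.update y j x) i * y i := fun x =>
    sum_congr rfl fun i hi => by rw [Function.update_of_ne (ne_of_mem_erase hi)]
  simp only [herase]
  set X : ℝ → ℝ := fun x => π (Function.update y j x) j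
  set P : ℝ → ℝ := fun x => p (Function.update y j x) -
    ∑ i ∈ univ.erase j, π (Function.update y j x) i * y i with hP
  have hutil : ∀ x x' : ℝ, π (Function.update y j x') ⬝ᵥ Function.update y j x -
      p (Function.update y j x') = X x' * x - P x' := fun x x' => by
    rw [dotProduct_update]; simp only [X, P]; ring
  have hone : ∑ x ∈ H, w j x * P x ≤ q * ∑ x ∈ A j with q ≤ x ∧ x < a, w j x := by
    refine sum_payment_le_of_posted_price_le H (w j) X P _
      (fun x hx => hw j x (hxa x hx).1)
      (fun x hx => hM.probability _ (mem_coe.2 (mem_filter.1 hx).2) j)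
      (fun s hs t ht => ?_) (fun t ht => ?_) (fun r hr => ?_) ?_
    · rw [← hutil, ← hutil]
      exact hM.incentiveCompatible _ (mem_coe.2 (mem_filter.1 ht).2) _
        (mem_coe.2 (mem_filter.1 hs).2)
    · rw [← hutil]
      exact hM.individuallyRational _ (mem_coe.2 (mem_filter.1 ht).2)
    · refine le_trans ?_ (hmax r (mem_insert_of_mem (hxa r hr).1))
      refine mul_le_mul_of_nonneg_left ?_ (hA j r (hxa r hr).1)
      refine sum_le_sum_of_subset_of_nonneg (fun x hx => ?_)
        fun x hx _ => hw j x (mem_filter.1 hx).1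
      obtain ⟨h1, h2⟩ := mem_filter.1 hx
      exact mem_filter.2 ⟨(hxa x h1).1, h2, (hxa x h1).2⟩
    · exact mul_nonneg hq0 (sum_nonneg fun x hx => hw j x (mem_filter.1 hx).1)
  calc ∑ x ∈ H, W * w j x * P x = W * ∑ x ∈ H, w j x * P x := by
        rw [mul_sum]; exact sum_congr rfl fun x _ => by ring
    _ ≤ W * (q * ∑ x ∈ A j with q ≤ x ∧ x < a, w j x) := mul_le_mul_of_nonneg_left hone hW
    _ = q * ∑ x ∈ A j with q ≤ x ∧ x < a, W * w j x := by rw [← mul_sum]; ring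
    _ ≤ _ := by
        refine mul_le_mul_of_nonneg_left ?_ hq0
        refine sum_le_sum_of_subset_of_nonneg (fun x hx => ?_)
          fun x hx _ => mul_nonneg hW (hw j x (mem_filter.1 hx).1)
        obtain ⟨h1, h2, h3⟩ := mem_filter.1 hx
        exact mem_filter.2 ⟨h1, h2, by linarith⟩

/-! ### The other items: a tail bound by exchanging coordinates -/

/-- The profile with the coordinates of `u` up to and including `k`, and those of `v` after `k`. -/
def splice {m : ℕ} (k : Fin m) (u v : Fin m → ℝ) : Fin m → ℝ := fun i => if i ≤ k then u i else v i

theorem sum_splice {m : ℕ} (k : Fin m) (u v : Fin m → ℝ) :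
    ∑ i, splice k u v i = ∑ i with i ≤ k, u i + ∑ i with ¬ i ≤ k, v i := by
  simp only [splice, sum_ite]

theorem splice_splice {m : ℕ} (k : Fin m) (u v : Fin m → ℝ) :
    splice k (splice k u v) (splice k v u) = u := by
  funext i; by_cases h : i ≤ k <;> simp [splice, h]

theorem prod_splice_mul_prod_splice {m : ℕ} (w : Fin m → ℝ → ℝ) (k : Fin m) (u v : Fin m → ℝ) :
    (∏ i, w i (splice k u v i)) * ∏ i, w i (splice k v u i) =
      (∏ i, w i (u i)) * ∏ i, w i (v i) := by
  rw [← prod_mul_distrib, ← prod_mul_distrib]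
  refine prod_congr rfl fun i _ => ?_
  by_cases h : i ≤ k
  · simp [splice, h]
  · simp [splice, h, mul_comm]

theorem splice_mem_piFinset {m : ℕ} {A : Fin m → Finset ℝ} (k : Fin m) {u v : Fin m → ℝ}
    (hu : u ∈ Fintype.piFinset A) (hv : v ∈ Fintype.piFinset A) :
    splice k u v ∈ Fintype.piFinset A := by
  rw [Fintype.mem_piFinset] at *
  intro i; by_cases h : i ≤ k
  · simpa [splice, h] using hu i
  · simpa [splice, h] using hv i

/-- `k` is the coordinate at which the partial sums of `u` reach the level `t`: the coordinates
before `k` add up to less than `t`, and those up to and including `k` to at least `t`. -/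
def Crosses {m : ℕ} (t : ℝ) (u : Fin m → ℝ) (k : Fin m) : Prop :=
  ∑ i with i < k, u i < t ∧ t ≤ ∑ i with i ≤ k, u i

theorem Crosses.splice {m : ℕ} {t : ℝ} {u : Fin m → ℝ} {k : Fin m} (h : Crosses t u k)
    (v : Fin m → ℝ) : Crosses t (splice k u v) k := by
  have h1 : ∑ i with i < k, BudgetAuction.splice k u v i = ∑ i with i < k, u i :=
    sum_congr rfl fun i hi => if_pos (mem_filter.1 hi).2.le
  have h2 : ∑ i with i ≤ k, BudgetAuction.splice k u v i = ∑ i with i ≤ k, u i :=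
    sum_congr rfl fun i hi => if_pos (mem_filter.1 hi).2
  exact ⟨h1.trans_lt h.1, h.2.trans_eq h2.symm⟩

theorem Crosses.unique {m : ℕ} {t : ℝ} {u : Fin m → ℝ} (hu : ∀ i, 0 ≤ u i) {k l : Fin m}
    (hk : Crosses t u k) (hl : Crosses t u l) : k = l := by
  have key : ∀ {k l : Fin m}, Crosses t u k → Crosses t u l → ¬ k < l := fun {k l} hk hl h => by
    have : ∑ i with i ≤ k, u i ≤ ∑ i with i < l, u i :=
      sum_le_sum_of_subset_of_nonneg
        (fun i hi => mem_filter.2 ⟨mem_univ _, (mem_filter.1 hi).2.trans_lt h⟩) fun i _ _ => hu i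
    linarith [hk.2, hl.1]
  exact le_antisymm (not_lt.1 (key hl hk)) (not_lt.1 (key hk hl))

theorem exists_crosses {m : ℕ} {t : ℝ} (ht : 0 < t) {u : Fin m → ℝ} (h : t ≤ ∑ i, u i) :
    ∃ k, Crosses t u k := by
  classical
  have hne : (univ.filter fun k : Fin m => t ≤ ∑ i with i ≤ k, u i).Nonempty := by
    cases m with
    | zero => simp at h; linarith
    | succ n =>
      refine ⟨Fin.last n, mem_filter.2 ⟨mem_univ _, ?_⟩⟩
      rwa [filter_true_of_mem fun i _ => Fin.le_last i]
  refine ⟨_, ?_, (mem_filter.1 (min'_mem _ hne)).2⟩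
  set k := min' _ hne with hk
  by_contra hlt
  rw [not_lt] at hlt
  have hk0 : (univ.filter fun i : Fin m => i < k).Nonempty := by
    by_contra h0
    rw [not_nonempty_iff_eq_empty] at h0
    rw [h0, sum_empty] at hlt
    linarith
  set l := max' _ hk0 with hl
  have hlk : l < k := (mem_filter.1 (max'_mem _ hk0)).2
  have he : (univ.filter fun i : Fin m => i < k) = univ.filter fun i => i ≤ l := by
    ext i
    simp only [mem_filter, mem_univ, true_and]
    exact ⟨fun hi => le_max' _ i (by simpa using hi), fun hi => hi.trans_lt hlk⟩
  rw [he] at hlt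
  exact absurd (min'_le _ l (mem_filter.2 ⟨mem_univ _, hlt⟩)) (not_le.2 hlk)

/-- A Hoffmann-Jørgensen inequality for a product weight restricted to `∑ i, v i ≤ c`: for
`Z = ∑ i, u i - max u` and `S = ∑ i, u i`, it says `Pr[Z ≥ 2t, S < a] * Pr[S < t] ≤ Pr[S ≥ t] ^ 2`.
Given `u` in the first event and `v` in the second, let `k` be the coordinate at which the partial
sums of `u` reach `t`. Since `Z ≥ 2t`, the coordinates of `u` after `k` add up to at least `t` as
well. Exchanging the coordinates of `u` and `v` after `k` thus gives two profiles of sum at least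
`t`, and at most `a + t ≤ 2 * a ≤ c`. The exchange preserves the product of the weights, and it is
injective because `k` can be read off the first of the two new profiles. -/
theorem sum_nonfavorite_mul_sum_le_sq {m : ℕ} (A : Fin m → Finset ℝ) (hA : ∀ i, ∀ x ∈ A i, 0 ≤ x)
    (w : Fin m → ℝ → ℝ) (hw : ∀ i, ∀ x ∈ A i, 0 ≤ w i x) (fav : (Fin m → ℝ) → Fin m)
    (hfav : ∀ (v : Fin m → ℝ) i, v i ≤ v (fav v)) {a c t : ℝ} (ht : 0 < t) (hta : t ≤ a) (hac : 2 * a ≤ c) :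
    (∑ u ∈ Fintype.piFinset A with 2 * t ≤ ∑ i, u i - u (fav u) ∧ ∑ i, u i < a, ∏ i, w i (u i)) *
      (∑ v ∈ Fintype.piFinset A with ∑ i, v i < t, ∏ i, w i (v i)) ≤
    (∑ u ∈ Fintype.piFinset A with t ≤ ∑ i, u i ∧ ∑ i, u i ≤ c, ∏ i, w i (u i)) ^ 2 := by
  classical
  have hnn : ∀ {u}, u ∈ Fintype.piFinset A → ∀ i, 0 ≤ u i := fun {u} hu i =>
    hA i _ (Fintype.mem_piFinset.1 hu i)
  have hpart : ∀ {u}, u ∈ Fintype.piFinset A → ∀ s : Finset (Fin m),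
      0 ≤ ∑ i ∈ s, u i ∧ ∑ i ∈ s, u i ≤ ∑ i, u i := fun {u} hu s =>
    ⟨sum_nonneg fun i _ => hnn hu i,
      sum_le_sum_of_subset_of_nonneg (subset_univ s) fun i _ _ => hnn hu i⟩
  have hex : ∀ u : Fin m → ℝ, ∃ k, t ≤ ∑ i, u i → Crosses t u k := fun u => by
    by_cases h : t ≤ ∑ i, u i
    · obtain ⟨k, hk⟩ := exists_crosses ht h
      exact ⟨k, fun _ => hk⟩
    · exact ⟨fav u, fun h' => absurd h' h⟩
  choose τ hτ using hex
  rw [sq, sum_mul_sum, sum_mul_sum, ← sum_product', ← sum_product']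
  set P := (Fintype.piFinset A).filter fun u => 2 * t ≤ ∑ i, u i - u (fav u) ∧ ∑ i, u i < a
  set Q := (Fintype.piFinset A).filter fun v => ∑ i, v i < t
  set X := (Fintype.piFinset A).filter fun u => t ≤ ∑ i, u i ∧ ∑ i, u i ≤ c
  have hcross : ∀ u ∈ P, Crosses t u (τ u) := fun u hu => by
    obtain ⟨huF, h1, -⟩ := mem_filter.1 hu
    exact hτ u (by linarith [hnn huF (fav u)])
  let φ : (Fin m → ℝ) × (Fin m → ℝ) → (Fin m → ℝ) × (Fin m → ℝ) := fun z =>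
    (splice (τ z.1) z.1 z.2, splice (τ z.1) z.2 z.1)
  have hmaps : ∀ z ∈ P ×ˢ Q, φ z ∈ X ×ˢ X := by
    rintro ⟨u, v⟩ hz
    obtain ⟨hu, hv⟩ := mem_product.1 hz
    have hc := hcross u hu
    obtain ⟨huF, h1, h2⟩ := mem_filter.1 hu
    obtain ⟨hvF, h3⟩ := mem_filter.1 hv
    dsimp only at *
    set k := τ u with hk
    have hsplit := sum_filter_add_sum_filter_not univ (fun i => i ≤ k) u
    have hle : ∑ i with i ≤ k, u i = ∑ i with i < k, u i + u k := by
      have : (univ.filter fun i : Fin m => i ≤ k) = insert k (univ.filter fun i => i < k) := by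
        ext i; simp [le_iff_eq_or_lt]
      rw [this, sum_insert (by simp), add_comm]
    have hfk := hfav u k
    have p1 := hpart huF (univ.filter fun i => i ≤ k)
    have p2 := hpart huF (univ.filter fun i => ¬ i ≤ k)
    have p3 := hpart hvF (univ.filter fun i => i ≤ k)
    have p4 := hpart hvF (univ.filter fun i => ¬ i ≤ k)
    refine mem_product.2 ⟨mem_filter.2 ⟨splice_mem_piFinset _ huF hvF, ?_⟩,
      mem_filter.2 ⟨splice_mem_piFinset _ hvF huF, ?_⟩⟩ <;>
    · simp only [φ, ← hk, sum_splice]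
      constructor <;> linarith [hc.1, hc.2]
  have hinj : Set.InjOn φ (P ×ˢ Q : Finset _) := by
    rintro ⟨u, v⟩ hz ⟨u', v'⟩ hz' h
    obtain ⟨hu, hv⟩ := mem_product.1 (mem_coe.1 hz)
    obtain ⟨hu', hv'⟩ := mem_product.1 (mem_coe.1 hz')
    have hF := (mem_filter.1 (mem_product.1 (hmaps _ hz)).1).1
    obtain ⟨e1, e2⟩ := Prod.mk.inj h
    simp only at e1 e2
    have c1 := (hcross u hu).splice v
    have c2 := (hcross u' hu').splice v'
    rw [← e1] at c2
    have hk : τ u = τ u' := c1.unique (hnn hF) c2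
    rw [← hk] at e1 e2
    ext1
    · change u = u'
      rw [← splice_splice (τ u) u v, e1, e2, splice_splice]
    · change v = v'
      rw [← splice_splice (τ u) v u, e1, e2, splice_splice]
  calc ∑ z ∈ P ×ˢ Q, (∏ i, w i (z.1 i)) * ∏ i, w i (z.2 i)
      = ∑ z ∈ P ×ˢ Q, (∏ i, w i ((φ z).1 i)) * ∏ i, w i ((φ z).2 i) :=
        sum_congr rfl fun z _ => (prod_splice_mul_prod_splice w _ _ _).symm
    _ = ∑ z ∈ (P ×ˢ Q).image φ, (∏ i, w i (z.1 i)) * ∏ i, w i (z.2 i) :=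
        (sum_image (f := fun z : (Fin m → ℝ) × (Fin m → ℝ) =>
          (∏ i, w i (z.1 i)) * ∏ i, w i (z.2 i)) hinj).symm
    _ ≤ ∑ z ∈ X ×ˢ X, (∏ i, w i (z.1 i)) * ∏ i, w i (z.2 i) := by
        refine sum_le_sum_of_subset_of_nonneg (image_subset_iff.2 hmaps) fun z hz _ => ?_
        obtain ⟨h1, h2⟩ := mem_product.1 hz
        exact mul_nonneg
          (prod_nonneg fun i _ => hw i _ (Fintype.mem_piFinset.1 (mem_filter.1 h1).1 i))
          (prod_nonneg fun i _ => hw i _ (Fintype.mem_piFinset.1 (mem_filter.1 h2).1 i))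

/-- Layer-cake estimate of a mean from the tail bounds `1`, `B / s` and `(80 / 13) B² / s²`, used on
`[0, B]`, `[B, 8B]` and `[8B, ∞)`: the integral is `(1 + log 8 + 10 / 13) * B < 4 * B`. -/
theorem sum_mul_le_of_tail_le {ι : Type*} (T : Finset ι) (d Z : ι → ℝ) {B : ℝ} (hB : 0 < B)
    (hd : ∀ i ∈ T, 0 ≤ d i) (hZ : ∀ i ∈ T, 0 ≤ Z i) (h1 : ∑ i ∈ T, d i ≤ 1)
    (h2 : ∀ s, 0 < s → ∑ i ∈ T with s ≤ Z i, d i ≤ B / s)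
    (h3 : ∀ s, 8 * B ≤ s → ∑ i ∈ T with s ≤ Z i, d i ≤ 80 / 13 * B ^ 2 / s ^ 2) :
    ∑ i ∈ T, d i * Z i ≤ 4 * B := by
  -- An upper end for the integration, beyond `8 * B` and all the values of `Z`.
  set L := 8 * B + ∑ i ∈ T, Z i with hL
  have hZs : 0 ≤ ∑ i ∈ T, Z i := sum_nonneg hZ
  set h : ℝ → ℝ := fun s => ∑ i ∈ T with s ≤ Z i, d i with hh
  have hanti : Antitone h := fun s s' hs =>
    sum_le_sum_of_subset_of_nonneg
      (fun i hi => mem_filter.2 ⟨(mem_filter.1 hi).1, hs.trans (mem_filter.1 hi).2⟩)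
      fun i hi _ => hd i (mem_filter.1 hi).1
  have hint : ∀ x y, IntervalIntegrable h MeasureTheory.volume x y := fun x y =>
    hanti.intervalIntegrable
  have hlayer : ∑ i ∈ T, d i * Z i = ∫ s in (0 : ℝ)..L, h s := by
    have e1 : ∀ s, h s = ∑ i ∈ T, Set.indicator {x | x ≤ Z i} (fun _ => d i) s := fun s => by
      simp only [hh, sum_filter, Set.indicator_apply, Set.mem_ofPred_eq]
    simp only [e1]
    rw [intervalIntegral.integral_finsetSum]
    · refine sum_congr rfl fun i hi => ?_
      have hiL : Z i ≤ L := by linarith [single_le_sum hZ hi]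
      rw [intervalIntegral.integral_indicator (a₁ := 0) (a₂ := Z i) (a₃ := L) ⟨hZ i hi, hiL⟩]
      simp [mul_comm]
    · intro i hi
      apply Antitone.intervalIntegrable
      intro s s' hs
      simp only [Set.indicator_apply, Set.mem_ofPred_eq]
      have := hd i hi
      split_ifs <;> linarith
  have hinv : ∀ {x y : ℝ}, 0 < x → x ≤ y → ∀ n : ℕ, IntervalIntegrable (fun s : ℝ => 1 / s ^ n)
      MeasureTheory.volume x y := fun {x y} hx hxy n => by
    apply ContinuousOn.intervalIntegrable
    rw [Set.uIcc_of_le hxy]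
    exact continuousOn_const.div (continuousOn_pow n) fun s hs =>
      pow_ne_zero n (hx.trans_le hs.1).ne'
  have i1 : ∫ s in (0 : ℝ)..B, h s ≤ B := by
    have : ∫ s in (0 : ℝ)..B, h s ≤ ∫ _ in (0 : ℝ)..B, (1 : ℝ) :=
      intervalIntegral.integral_mono_on hB.le (hint _ _) intervalIntegrable_const fun s _ =>
        (sum_le_sum_of_subset_of_nonneg (filter_subset _ _) fun i hi _ => hd i hi).trans h1
    simpa using this
  have i2 : ∫ s in B..(8 * B), h s ≤ 3 * 0.6931471808 * B := by
    have hle : B ≤ 8 * B := by linarith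
    have hi : IntervalIntegrable (fun s : ℝ => B * (1 / s)) MeasureTheory.volume B (8 * B) := by
      simpa using (hinv hB hle 1).const_mul B
    calc ∫ s in B..(8 * B), h s ≤ ∫ s in B..(8 * B), B * (1 / s) :=
          intervalIntegral.integral_mono_on hle (hint _ _) hi fun s hs =>
            (h2 s (hB.trans_le hs.1)).trans_eq (by ring)
      _ = B * Real.log 8 := by
          rw [intervalIntegral.integral_const_mul, integral_one_div_of_pos hB (by linarith),
            mul_div_assoc, div_self hB.ne', mul_one]
      _ ≤ _ := by
          have : Real.log 8 = 3 * Real.log 2 := by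
            rw [show (8 : ℝ) = 2 ^ 3 by norm_num, Real.log_pow]; norm_num
          rw [this]
          nlinarith [Real.log_two_lt_d9]
  have i3 : ∫ s in (8 * B)..L, h s ≤ 10 / 13 * B := by
    have hle : 8 * B ≤ L := by linarith
    have h8 : 0 < 8 * B := by linarith
    have hi := (hinv h8 hle 2).const_mul (80 / 13 * B ^ 2)
    calc ∫ s in (8 * B)..L, h s ≤ ∫ s in (8 * B)..L, 80 / 13 * B ^ 2 * (1 / s ^ 2) :=
          intervalIntegral.integral_mono_on hle (hint _ _) hi fun s hs =>
            (h3 s hs.1).trans_eq (by ring)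
      _ = 80 / 13 * B ^ 2 * (1 / (8 * B) - 1 / L) := by
          rw [intervalIntegral.integral_const_mul]
          congr 1
          rw [intervalIntegral.integral_eq_sub_of_hasDerivAt (f := fun s : ℝ => - s⁻¹)]
          · field_simp; ring
          · intro s hs
            rw [Set.uIcc_of_le hle] at hs
            have := (hasDerivAt_inv (h8.trans_le hs.1).ne').fun_neg
            simpa using this
          · exact hinv h8 hle 2
      _ ≤ 80 / 13 * B ^ 2 * (1 / (8 * B)) := by
          have : 0 ≤ 1 / L := one_div_nonneg.2 (by linarith)
          have h' : 0 ≤ 80 / 13 * B ^ 2 := by positivity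
          nlinarith
      _ = 10 / 13 * B := by field_simp; norm_num
  rw [hlayer, ← intervalIntegral.integral_add_adjacent_intervals (hint 0 B) (hint B L),
    ← intervalIntegral.integral_add_adjacent_intervals (hint B (8 * B)) (hint (8 * B) L)]
  linarith

/-! ### Lower bounds for the simple revenues -/

/-- A type of total value at most `b` is not constrained by the budget: it buys every item whose
price does not exceed its value. The other types pay a nonnegative amount, which is dropped. -/
theorem sum_mul_price_le_SRev {m : ℕ} {b : ℝ} (hb : 0 ≤ b) (D : PMF (Fin m → ℝ))
    (hD : ∀ t ∈ D.support, ∀ j, 0 ≤ t j) (q : Fin m → ℝ) (hq : ∀ j, 0 ≤ q j)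
    (G : Finset (Fin m → ℝ)) (hG : ∀ v ∈ G, ∑ i, v i ≤ b) :
    ∑ v ∈ G, (D v).toReal * ∑ j, (if q j ≤ v j then q j else 0) ≤ SRev b D := by
  classical
  choose S₀ hS₀ using exists_isOptimalPurchase hb q
  set S : (Fin m → ℝ) → Finset (Fin m) := fun t =>
    if ∑ i, t i ≤ b then univ.filter fun j => q j ≤ t j else S₀ t with hSdef
  have hopt : ∀ t ∈ D.support, IsOptimalPurchase b q t (S t) := fun t ht => by
    by_cases h : ∑ i, t i ≤ b
    · simp only [hSdef, if_pos h]
      refine ⟨?_, fun S' _ => ?_⟩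
      · calc ∑ j with q j ≤ t j, q j ≤ ∑ j with q j ≤ t j, t j :=
              sum_le_sum fun j hj => (mem_filter.1 hj).2
          _ ≤ ∑ j, t j :=
              sum_le_sum_of_subset_of_nonneg (filter_subset _ _) fun j _ _ => hD t ht j
          _ ≤ b := h
      · calc ∑ j ∈ S', (t j - q j) ≤ ∑ j ∈ S' with q j ≤ t j, (t j - q j) := by
              rw [sum_filter]
              refine sum_le_sum fun j _ => ?_
              split_ifs with hj
              · exact le_rfl
              · linarith
          _ ≤ ∑ j with q j ≤ t j, (t j - q j) :=
              sum_le_sum_of_subset_of_nonneg (filter_subset_filter _ (subset_univ _))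
                fun j hj _ => sub_nonneg.2 (mem_filter.1 hj).2
    · simp only [hSdef, if_neg h]
      exact hS₀ t
  have hpay : ∀ t, 0 ≤ (D t).toReal * ∑ j ∈ S t, q j := fun t =>
    mul_nonneg ENNReal.toReal_nonneg (sum_nonneg fun j _ => hq j)
  have hsum : Summable fun t => (D t).toReal * ∑ j ∈ S t, q j := by
    refine Summable.of_nonneg_of_le hpay (fun t => ?_) ((hasSum_toReal D).mul_right b).summable
    by_cases ht : t ∈ D.support
    · exact mul_le_mul_of_nonneg_left (hopt t ht).1 ENNReal.toReal_nonneg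
    · have h0 : D t = 0 := by simpa [PMF.mem_support_iff] using ht
      simp [h0]
  calc ∑ v ∈ G, (D v).toReal * ∑ j, (if q j ≤ v j then q j else 0)
      = ∑ v ∈ G, (D v).toReal * ∑ j ∈ S v, q j :=
        sum_congr rfl fun v hv => by simp only [hSdef, if_pos (hG v hv), sum_filter]
    _ ≤ ∑' t, (D t).toReal * ∑ j ∈ S t, q j := hsum.sum_le_tsum _ fun t _ => hpay t
    _ ≤ SRev b D :=
        le_csSup (separateRevenues_bddAbove b D) ⟨q, S, hq, hopt, hsum.hasSum⟩

theorem mul_sum_le_BRev {m : ℕ} {b s : ℝ} (D : PMF (Fin m → ℝ)) (hs : 0 ≤ s) (hsb : s ≤ b)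
    (G : Finset (Fin m → ℝ)) (hG : ∀ v ∈ G, s ≤ ∑ i, v i) :
    s * ∑ v ∈ G, (D v).toReal ≤ BRev b D := by
  refine le_trans ?_ (le_csSup (bundleRevenues_bddAbove b D) ⟨s, hs, hsb, rfl⟩)
  refine mul_le_mul_of_nonneg_left ?_ hs
  rw [← ENNReal.toReal_sum fun v _ => D.apply_ne_top v, ← PMF.toOuterMeasure_apply_finset]
  refine ENNReal.toReal_mono ?_ (MeasureTheory.measure_mono fun v hv => hG v (mem_coe.1 hv))
  refine ne_top_of_le_ne_top ENNReal.one_ne_top ?_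
  rw [PMF.toOuterMeasure_apply, ← D.tsum_coe]
  exact ENNReal.tsum_le_tsum fun t => Set.indicator_le_self _ _ t

theorem SRev_nonneg {m : ℕ} {b : ℝ} (hb : 0 ≤ b) (D : PMF (Fin m → ℝ)) : 0 ≤ SRev b D := by
  obtain ⟨R, q, S, hq, hS, hR⟩ := separateRevenues_nonempty hb D
  exact (hR.nonneg fun t => mul_nonneg ENNReal.toReal_nonneg (sum_nonneg fun j _ => hq j)).trans
    (le_csSup (separateRevenues_bddAbove b D) ⟨q, S, hq, hS, hR⟩)

theorem BRev_nonneg {m : ℕ} {b : ℝ} (hb : 0 ≤ b) (D : PMF (Fin m → ℝ)) : 0 ≤ BRev b D := by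
  simpa using mul_sum_le_BRev D le_rfl hb ∅ (by simp)

/-! ### The upper bound on a finite box -/

/-- The revenue bound for a weight `d` on a finite box that is of product form where
`∑ i, v i ≤ c` and zero elsewhere, with `S` and `B` bounding the item-pricing and bundle-pricing
revenues on the box. Types of total value at least `a` contribute at most `2 * B`; on the others, the
favourite item contributes at most `S` and the remaining items at most `4 * B`. -/
theorem sum_payment_le_of_box {m : ℕ} (A : Fin m → Finset ℝ) (hA : ∀ i, ∀ x ∈ A i, 0 ≤ x)
    (w : Fin m → ℝ → ℝ) (hw : ∀ i, ∀ x ∈ A i, 0 ≤ w i x) (fav : (Fin m → ℝ) → Fin m)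
    (hfav : ∀ (v : Fin m → ℝ) i, v i ≤ v (fav v)) {a c K : ℝ} (ha : 0 < a) (hac : 2 * a ≤ c)
    (hK : 0 ≤ K) (d : (Fin m → ℝ) → ℝ)
    (hd : ∀ v ∈ Fintype.piFinset A, ∑ i, v i ≤ c → d v = K * ∏ i, w i (v i))
    (hd0 : ∀ v ∈ Fintype.piFinset A, c < ∑ i, v i → d v = 0)
    (hmass : ∑ v ∈ Fintype.piFinset A, d v ≤ 1) (hmass' : 9 / 10 ≤ ∑ v ∈ Fintype.piFinset A, d v)
    {b : ℝ} {π : (Fin m → ℝ) → (Fin m → ℝ)} {p : (Fin m → ℝ) → ℝ}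
    (hM : IsTruthful {v | v ∈ Fintype.piFinset A ∧ ∑ i, v i ≤ c} b π p)
    (hp : ∀ v ∈ Fintype.piFinset A, ∑ i, v i ≤ c → p v ≤ 2 * a) {S B : ℝ} (hB : 0 < B)
    (hS : ∀ q : Fin m → ℝ, (∀ j, 0 ≤ q j) → ∑ v ∈ Fintype.piFinset A with ∑ i, v i ≤ 2 * a,
      d v * ∑ j, (if q j ≤ v j then q j else 0) ≤ S)
    (hBs : ∀ s, 0 < s → s ≤ 2 * a → s * ∑ v ∈ Fintype.piFinset A with s ≤ ∑ i, v i, d v ≤ B) :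
    ∑ v ∈ Fintype.piFinset A, d v * p v ≤ S + 6 * B := by
  classical
  set F := Fintype.piFinset A with hF
  have hnn : ∀ {u}, u ∈ F → ∀ i, 0 ≤ u i := fun {u} hu i => hA i _ (Fintype.mem_piFinset.1 hu i)
  have hdn : ∀ v ∈ F, 0 ≤ d v := fun v hv => by
    rcases le_or_gt (∑ i, v i) c with h | h
    · rw [hd v hv h]
      exact mul_nonneg hK (prod_nonneg fun i _ => hw i _ (Fintype.mem_piFinset.1 hv i))
    · rw [hd0 v hv h]
  have htail : ∀ s, 0 < s → s ≤ 2 * a → ∑ v ∈ F with s ≤ ∑ i, v i, d v ≤ B / s :=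
    fun s hs hsa => by rw [le_div_iff₀ hs, mul_comm]; exact hBs s hs hsa
  have hhigh : ∑ v ∈ F with ¬ ∑ i, v i < a, d v * p v ≤ 2 * B := by
    calc ∑ v ∈ F with ¬ ∑ i, v i < a, d v * p v
        ≤ ∑ v ∈ F with a ≤ ∑ i, v i, d v * (2 * a) := by
          simp only [not_lt]
          refine sum_le_sum fun v hv => ?_
          have hvF := (mem_filter.1 hv).1
          rcases le_or_gt (∑ i, v i) c with h | h
          · exact mul_le_mul_of_nonneg_left (hp v hvF h) (hdn v hvF)
          · simp [hd0 v hvF h]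
      _ = 2 * (a * ∑ v ∈ F with a ≤ ∑ i, v i, d v) := by rw [← sum_mul]; ring
      _ ≤ 2 * B := by linarith [hBs a ha (by linarith)]
  set T := F.filter fun v => ∑ i, v i < a with hT
  have hTc : ∀ v ∈ T, v ∈ F ∧ ∑ i, v i < a ∧ ∑ i, v i ≤ c := fun v hv => by
    obtain ⟨h1, h2⟩ := mem_filter.1 hv
    exact ⟨h1, h2, by linarith⟩
  have hsingle : ∑ v ∈ T, d v * (p v - ∑ i ∈ univ.erase (fav v), π v i * v i) ≤ S := by
    have hj : ∀ j, ∃ q, 0 ≤ q ∧ ∑ v ∈ T with fav v = j,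
        (∏ i, w i (v i)) * (p v - ∑ i ∈ univ.erase j, π v i * v i) ≤
        q * ∑ v ∈ F with q ≤ v j ∧ ∑ i, v i ≤ 2 * a, ∏ i, w i (v i) := fun j =>
      exists_price_sum_payment_sub_le A hA w hw le_rfl j _
        (fun v hv => ⟨(hTc v (mem_filter.1 hv).1).1, (hTc v (mem_filter.1 hv).1).2.1⟩)
        (b := b) (π := π) (p := p)
        (hM.mono fun v hv => by
          have := hTc v (mem_filter.1 (mem_coe.1 hv)).1
          exact ⟨this.1, this.2.2⟩)
    choose q hq0 hq using hj
    refine le_trans ?_ (hS q hq0)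
    rw [← sum_fiberwise T fav]
    have hcomm : ∑ v ∈ F with ∑ i, v i ≤ 2 * a, d v * ∑ j, (if q j ≤ v j then q j else 0) =
        ∑ j, K * (q j * ∑ v ∈ F with q j ≤ v j ∧ ∑ i, v i ≤ 2 * a, ∏ i, w i (v i)) := by
      simp only [mul_sum]
      rw [sum_comm]
      refine sum_congr rfl fun j _ => ?_
      have : (F.filter fun v => q j ≤ v j ∧ ∑ i, v i ≤ 2 * a) =
          (F.filter fun v => ∑ i, v i ≤ 2 * a).filter fun v => q j ≤ v j := by
        rw [filter_filter]; simp only [and_comm]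
      rw [this, sum_filter (fun v : Fin m → ℝ => q j ≤ v j)]
      refine sum_congr rfl fun v hv => ?_
      obtain ⟨h1, h2⟩ := mem_filter.1 hv
      rw [hd v h1 (h2.trans hac)]
      split_ifs <;> ring
    rw [hcomm]
    refine sum_le_sum fun j _ => ?_
    refine le_trans (le_of_eq ?_) (mul_le_mul_of_nonneg_left (hq j) hK)
    rw [mul_sum]
    refine sum_congr rfl fun v hv => ?_
    obtain ⟨h1, rfl⟩ := mem_filter.1 hv
    obtain ⟨h2, -, h3⟩ := hTc v h1
    rw [hd v h2 h3]; ring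
  have hZle : ∀ v ∈ F, 0 ≤ ∑ i, v i - v (fav v) ∧ ∑ i, v i - v (fav v) ≤ ∑ i, v i :=
    fun v hv => ⟨sub_nonneg.2 (single_le_sum (fun i _ => hnn hv i) (mem_univ _)),
      sub_le_self _ (hnn hv _)⟩
  have hnonfav : ∑ v ∈ T, d v * (∑ i, v i - v (fav v)) ≤ 4 * B := by
    have hempty : ∀ s, a < s → ∑ v ∈ T with s ≤ ∑ i, v i - v (fav v), d v = 0 := fun s hs => by
      refine sum_eq_zero fun v hv => ?_
      obtain ⟨h1, h2⟩ := mem_filter.1 hv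
      obtain ⟨h3, h4, -⟩ := hTc v h1
      linarith [(hZle v h3).2]
    refine sum_mul_le_of_tail_le T d _ hB (fun v hv => hdn v (hTc v hv).1)
      (fun v hv => (hZle v (hTc v hv).1).1) ?_ (fun s hs => ?_) (fun s hs => ?_)
    · exact (sum_le_sum_of_subset_of_nonneg (filter_subset _ _) fun v hv _ => hdn v hv).trans hmass
    · rcases le_or_gt s a with hsa | hsa
      · refine le_trans ?_ (htail s hs (by linarith))
        refine sum_le_sum_of_subset_of_nonneg (fun v hv => ?_)
          fun v hv _ => hdn v (mem_filter.1 hv).1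
        obtain ⟨h1, h2⟩ := mem_filter.1 hv
        have h3 := (hTc v h1).1
        exact mem_filter.2 ⟨h3, h2.trans (hZle v h3).2⟩
      · rw [hempty s hsa]; positivity
    · rcases le_or_gt s a with hsa | hsa
      · have hs0 : 0 < s := by linarith
        have ht0 : 0 < s / 2 := by linarith
        -- With `t = s / 2 ≥ 4 * B`, the mass of `∑ i, v i ≥ t` is at most `1 / 4`, which leaves at least
        -- `9 / 10 - 1 / 4 = 13 / 20` below `t` as the second factor of the exchange inequality.
        have hswap := sum_nonfavorite_mul_sum_le_sq A hA w hw fav hfav ht0 (by linarith) hac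
        have hscale : ∀ (P : (Fin m → ℝ) → Prop) [DecidablePred P], (∀ v ∈ F, P v → ∑ i, v i ≤ c) →
            ∑ v ∈ F with P v, d v = K * ∑ v ∈ F with P v, ∏ i, w i (v i) := fun P _ hP => by
          rw [mul_sum]
          exact sum_congr rfl fun v hv =>
            hd v (mem_filter.1 hv).1 (hP v (mem_filter.1 hv).1 (mem_filter.1 hv).2)
        have e1 : ∑ v ∈ T with s ≤ ∑ i, v i - v (fav v), d v =
            K * ∑ u ∈ F with 2 * (s / 2) ≤ ∑ i, u i - u (fav u) ∧ ∑ i, u i < a,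
              ∏ i, w i (u i) := by
          rw [← hscale (fun u => 2 * (s / 2) ≤ ∑ i, u i - u (fav u) ∧ ∑ i, u i < a)
            fun v _ h => by linarith [h.2], hT, filter_filter]
          simp only [and_comm, mul_div_cancel₀ s (two_ne_zero' ℝ)]
        have e2 := hscale (fun v => ∑ i, v i < s / 2) fun v _ h => by linarith
        have e3 := hscale (fun v => s / 2 ≤ ∑ i, v i ∧ ∑ i, v i ≤ c) fun v _ h => h.2
        have h5 : ∑ v ∈ F with s / 2 ≤ ∑ i, v i ∧ ∑ i, v i ≤ c, d v ≤
            ∑ v ∈ F with s / 2 ≤ ∑ i, v i, d v :=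
          sum_le_sum_of_subset_of_nonneg
            (fun v hv => mem_filter.2 ⟨(mem_filter.1 hv).1, (mem_filter.1 hv).2.1⟩)
            fun v hv _ => hdn v (mem_filter.1 hv).1
        have h5' : 0 ≤ ∑ v ∈ F with s / 2 ≤ ∑ i, v i ∧ ∑ i, v i ≤ c, d v :=
          sum_nonneg fun v hv => hdn v (mem_filter.1 hv).1
        have h6 := htail (s / 2) ht0 (by linarith)
        have h7 : B / (s / 2) ≤ 1 / 4 := by rw [div_le_iff₀ ht0]; linarith
        have h8 := sum_filter_add_sum_filter_not F (fun v => ∑ i, v i < s / 2) d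
        simp only [not_lt] at h8
        set x := ∑ v ∈ T with s ≤ ∑ i, v i - v (fav v), d v
        have hx : 0 ≤ x := sum_nonneg fun v hv => hdn v (hTc v (mem_filter.1 hv).1).1
        set y := ∑ v ∈ F with ∑ i, v i < s / 2, d v
        set z := ∑ v ∈ F with s / 2 ≤ ∑ i, v i ∧ ∑ i, v i ≤ c, d v
        have h9 : x * y ≤ z ^ 2 := by
          rw [e1, e2, e3]
          calc _ = K ^ 2 * _ := by rw [mul_mul_mul_comm, ← sq]
            _ ≤ K ^ 2 * _ := mul_le_mul_of_nonneg_left hswap (sq_nonneg K)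
            _ = _ := by rw [mul_pow]
        have h10 : z ^ 2 ≤ (B / (s / 2)) ^ 2 := pow_le_pow_left₀ h5' (h5.trans h6) 2
        have h11 : x * (13 / 20) ≤ x * y := mul_le_mul_of_nonneg_left (by linarith) hx
        have h12 : (B / (s / 2)) ^ 2 = 4 * (B ^ 2 / s ^ 2) := by field_simp; norm_num
        calc x ≤ 20 / 13 * (4 * (B ^ 2 / s ^ 2)) := by linarith
          _ = _ := by ring
      · rw [hempty s hsa]; positivity
  have hlow : ∑ v ∈ T, d v * p v ≤ S + 4 * B := by
    refine le_trans ?_ (add_le_add hsingle hnonfav)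
    rw [← sum_add_distrib]
    refine sum_le_sum fun v hv => ?_
    obtain ⟨h1, -, h3⟩ := hTc v hv
    rw [← mul_add]
    refine mul_le_mul_of_nonneg_left ?_ (hdn v h1)
    have : ∑ i ∈ univ.erase (fav v), π v i * v i ≤ ∑ i ∈ univ.erase (fav v), v i :=
      sum_le_sum fun i _ => mul_le_of_le_one_left (hnn h1 i) (hM.probability v ⟨h1, h3⟩ i).2
    linarith [sum_erase_add univ v (mem_univ (fav v))]
  rw [← sum_filter_add_sum_filter_not F fun v => ∑ i, v i < a]
  linarith

/-! ### From the box to the distribution -/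

/-- A finite box, spanned by coordinates of profiles in the support, that carries almost all of the
expected payment and at least a given part `δ < 1` of the mass. -/
theorem exists_box {m : ℕ} {D : PMF (Fin m → ℝ)} {p : (Fin m → ℝ) → ℝ} {R ε δ : ℝ}
    (hR : HasSum (fun t => (D t).toReal * p t) R) (hε : 0 < ε) (hδ : δ < 1) :
    ∃ A : Fin m → Finset ℝ, (∀ i, ∀ x ∈ A i, ∃ u ∈ D.support, u i = x) ∧
      R - ε ≤ ∑ v ∈ Fintype.piFinset A, (D v).toReal * p v ∧
      δ ≤ ∑ v ∈ Fintype.piFinset A, (D v).toReal := by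
  classical
  have h1 := hR.eventually (lt_mem_nhds (sub_lt_self R hε))
  have h2 := (hasSum_toReal D).eventually (lt_mem_nhds hδ)
  obtain ⟨F₀, hF₀⟩ := Filter.eventually_atTop.1 (h1.and h2)
  set A : Fin m → Finset ℝ := fun i => (F₀.filter (· ∈ D.support)).image fun u => u i with hA
  have hz : ∀ v ∈ F₀ ∪ Fintype.piFinset A, v ∉ Fintype.piFinset A → D v = 0 := fun v hv hvA => by
    by_contra h
    have hvF : v ∈ F₀ := (mem_union.1 hv).resolve_right hvA
    refine hvA (Fintype.mem_piFinset.2 fun i => mem_image_of_mem (fun u : Fin m → ℝ => u i) ?_)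
    exact mem_filter.2 ⟨hvF, (PMF.mem_support_iff _ _).2 h⟩
  obtain ⟨h3, h4⟩ := hF₀ (F₀ ∪ Fintype.piFinset A) subset_union_left
  rw [← sum_subset subset_union_right fun v hv hvA => by simp [hz v hv hvA]] at h3 h4
  refine ⟨A, fun i x hx => ?_, h3.le, h4.le⟩
  obtain ⟨u, hu, rfl⟩ := mem_image.1 hx
  exact ⟨u, (mem_filter.1 hu).2, rfl⟩

theorem Rev_le_SRev_add_six_mul_BRev {m : ℕ} {D : PMF (Fin m → ℝ)} (hD : IsWeaklyCorrelated D)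
    {b : ℝ} (hb : 0 < b) : Rev b D ≤ SRev b D + 6 * BRev b D := by
  classical
  obtain ⟨V, c, hcap, ⟨W, hW⟩, hV, hc, rfl⟩ := hD
  set D := capSum V c hcap with hDdef
  have hsupp : ∀ {t}, t ∈ D.support ↔ l1 t ≤ c ∧ t ∈ V.support := fun {t} =>
    PMF.mem_support_filter_iff hcap
  have hDnn : ∀ t ∈ D.support, ∀ j, 0 ≤ t j := fun t ht => hV t (hsupp.1 ht).2
  have hDle : ∀ t ∈ D.support, ∑ j, t j ≤ c := fun t ht => by
    rw [← l1_eq_sum (hDnn t ht)]; exact (hsupp.1 ht).1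
  refine csSup_le (truthfulRevenues_nonempty hb.le D) ?_
  rintro R ⟨π, p, hM, hR⟩
  rcases Nat.eq_zero_or_pos m with rfl | hm
  · have h0 : R ≤ 0 := le_of_hasSum (fun t ht => by
      simpa using hM.payment_le_sum ht (hDnn t ht)) hR
    linarith [SRev_nonneg hb.le D, BRev_nonneg hb.le D]
  have : NeZero m := ⟨hm.ne'⟩
  -- A favourite item of each profile, which exists only if there is an item.
  have hfav : ∀ v : Fin m → ℝ, ∃ j, ∀ i, v i ≤ v j := fun v => Finite.exists_max v
  choose fav hfav using hfav
  refine le_of_forall_pos_le_add fun ε hε => ?_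
  obtain ⟨A, hAsupp, hAR, hAmass⟩ := exists_box hR (half_pos hε) (by norm_num : (9 / 10 : ℝ) < 1)
  have hA : ∀ i, ∀ x ∈ A i, 0 ≤ x := fun i x hx => by
    obtain ⟨u, hu, rfl⟩ := hAsupp i x hx
    exact hDnn u hu i
  have hnn : ∀ {v}, v ∈ Fintype.piFinset A → ∀ i, 0 ≤ v i := fun {v} hv i =>
    hA i _ (Fintype.mem_piFinset.1 hv i)
  have hVA : ∀ v ∈ Fintype.piFinset A, v ∈ V.support := fun v hv => by
    rw [PMF.mem_support_iff, hW, prod_ne_zero_iff]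
    intro i _
    obtain ⟨u, hu, hui⟩ := hAsupp i _ (Fintype.mem_piFinset.1 hv i)
    have h1 := (PMF.mem_support_iff _ _).1 (hsupp.1 hu).2
    rw [hW, prod_ne_zero_iff] at h1
    rw [← hui]
    exact h1 i (mem_univ i)
  have hsub : ∀ v ∈ Fintype.piFinset A, ∑ i, v i ≤ c → v ∈ D.support := fun v hv h =>
    hsupp.2 ⟨by rwa [l1_eq_sum (hnn hv)], hVA v hv⟩
  have hmin : 0 < min b c := lt_min hb hc
  -- `BRev` is enlarged slightly because the bound on the box needs `0 < B`.
  have hbox := sum_payment_le_of_box A hA (fun i x => (W i x).toReal)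
    (fun i x _ => ENNReal.toReal_nonneg) fav hfav (a := min b c / 2) (c := c)
    (K := ((∑' t, Set.indicator {t : Fin m → ℝ | l1 t ≤ c} V t)⁻¹).toReal)
    (S := SRev b D) (B := BRev b D + ε / 12) (half_pos hmin)
    (by linarith [min_le_right b c]) ENNReal.toReal_nonneg (fun v => (D v).toReal)
    (fun v hv h => by
      have hv1 : v ∈ {t : Fin m → ℝ | l1 t ≤ c} := (l1_eq_sum (hnn hv)).trans_le h
      rw [hDdef, capSum, PMF.filter_apply, Set.indicator_of_mem hv1, hW, ENNReal.toReal_mul,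
        ENNReal.toReal_prod, mul_comm])
    (fun v hv h => by
      have : v ∉ D.support := fun hv' => absurd (hDle v hv') (not_le.2 h)
      rw [PMF.mem_support_iff, not_not] at this
      rw [this, ENNReal.toReal_zero])
    (sum_le_hasSum _ (fun t _ => ENNReal.toReal_nonneg) (hasSum_toReal D)) hAmass
    (hM.mono fun v hv => hsub v hv.1 hv.2)
    (fun v hv h => by
      rw [mul_div_cancel₀ _ (two_ne_zero' ℝ)]
      exact le_min (hM.withinBudget v (hsub v hv h))
        ((hM.payment_le_sum (hsub v hv h) (hnn hv)).trans h))
    (by linarith [BRev_nonneg hb.le D])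
    (fun q hq => sum_mul_price_le_SRev hb.le D hDnn q hq _ fun v hv => by
      linarith [(mem_filter.1 hv).2, min_le_left b c])
    (fun s hs hs2 => by
      have := mul_sum_le_BRev D hs.le (by linarith [min_le_left b c] : s ≤ b)
        ((Fintype.piFinset A).filter fun v => s ≤ ∑ i, v i) fun v hv => (mem_filter.1 hv).2
      linarith)
  linarith

end BudgetAuction

theorem corollary1 {m : ℕ} (D : PMF (Fin m → ℝ)) (hD : BudgetAuction.IsWeaklyCorrelated D)
    (b : ℝ) (hb : 0 < b) :
    BudgetAuction.Rev b D ≤ 5 * BudgetAuction.SRev b D + 6 * BudgetAuction.BRev b D := by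
  linarith [BudgetAuction.Rev_le_SRev_add_six_mul_BRev hD hb, BudgetAuction.SRev_nonneg hb.le D]
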